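/- Let $\mathrm{Cor}(2,2)$ be the set of quantum correlators, i.e. the set of real matrices $C=(c_{xy})\in\mathbb{R}^{2\times 2}$ of the form $c_{xy}=\mathrm{tr}\big(\rho\,(A_x\otimes B_y)\big)$ for $x,y\in\{1,2\}$, where $\rho$ is a quantum state (a positive semidefinite operator of trace one) on $\mathcal{H}_A\otimes\mathcal{H}_B$ for some complex Hilbert spaces $\mathcal{H}_A,\mathcal{H}_B$, and $A_1,A_2$ on $\mathcal{H}_A$ and $B_1,B_2$ on $\mathcal{H}_B$ are $\pm1$ observables (self-adjoint operators with square the identity). Let $C=(c_{xy})\in\mathrm{Cor}(2,2)$ and set $\theta_{xy}=\arccos(c_{xy})\in[0,\pi]$. (i) If $\mathrm{rank}\,C=1$, then $C$ is an extreme point of $\mathrm{Cor}(2,2)$ if and only if $C=ab^{\top}$ for some $a,b\in\{\pm1\}^2$. (ii) If $\mathrm{rank}\,C=2$, then $C$ is an extreme point of $\mathrm{Cor}(2,2)$ if and only if both of the following hold: exactly one of the eight cycle inequalities $$0\le \sum_{(x,y)\neq(x',y')}\theta_{xy}-\theta_{x'y'},\qquad \sum_{(x,y)\neq(x',y')}\theta_{xy}-\theta_{x'y'}\le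 2\pi\qquad (x',y'\in\{1,2\})$$ holds with equality, and at most one of the eight box inequalities $$0\le\theta_{xy},\qquad \theta_{xy}\le\pi\qquad (x,y\in\{1,2\})$$ holds with equality. -/

import Mathlib

open scoped TensorProduct InnerProductSpace

noncomputable section

namespace QuantumCorrelator

/-- `HasTrace T t`: the bounded operator `T` on the complex Hilbert space `K` is trace class with
trace `t`, i.e. for every orthonormal (Hilbert) basis `b` of `K` the family `⟪b i, T (b i)⟫` is
summable with sum `t`. -/
def HasTrace {K : Type} [NormedAddCommGroup K] [InnerProductSpace ℂ K] [CompleteSpace K]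
    (T : K →L[ℂ] K) (t : ℂ) : Prop :=
  ∀ (ι : Type) (b : HilbertBasis ι ℂ K), HasSum (fun i => ⟪b i, T (b i)⟫_ℂ) t

/-- A quantum state (density operator): a positive semidefinite operator of trace one. -/
def IsState {K : Type} [NormedAddCommGroup K] [InnerProductSpace ℂ K] [CompleteSpace K]
    (ρ : K →L[ℂ] K) : Prop :=
  ρ.IsPositive ∧ HasTrace ρ 1

/-- A `±1` observable: a self-adjoint operator `A` with `A ^ 2 = 1`, that is, whose eigenvalues
are `1` and `-1` (or only one of them). -/
def IsObservable {H : Type} [NormedAddCommGroup H] [InnerProductSpace ℂ H] [CompleteSpace H]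
    (A : H →L[ℂ] H) : Prop :=
  IsSelfAdjoint A ∧ A ^ 2 = 1

/-- The Hilbert space tensor product of `HA` and `HB`: the completion of the algebraic tensor
product for the inner product `⟪a ⊗ b, a' ⊗ b'⟫ = ⟪a, a'⟫ * ⟪b, b'⟫`. -/
abbrev HilbertTensor (HA HB : Type) [NormedAddCommGroup HA] [InnerProductSpace ℂ HA]
    [NormedAddCommGroup HB] [InnerProductSpace ℂ HB] : Type :=
  UniformSpace.Completion (HA ⊗[ℂ] HB)

/-- The operator `A ⊗ B` on the Hilbert space tensor product. -/
def tensorOp {HA HB : Type} [NormedAddCommGroup HA] [InnerProductSpace ℂ HA]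
    [NormedAddCommGroup HB] [InnerProductSpace ℂ HB] (A : HA →L[ℂ] HA) (B : HB →L[ℂ] HB) :
    HilbertTensor HA HB →L[ℂ] HilbertTensor HA HB :=
  (TensorProduct.mapL A B).completion

/-- The set `Cor(n, m)` of quantum correlators, arranged as real `n × m` matrices: all `C` with
`C x y = tr (ρ (A x ⊗ B y))` for some complex Hilbert spaces `HA`, `HB`, a quantum state `ρ` on
their tensor product, and `±1` observables `A x` on `HA` and `B y` on `HB`. -/
def Cor (n m : ℕ) : Set (Matrix (Fin n) (Fin m) ℝ) :=
  {C | ∃ (HA HB : Type)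
      (_ : NormedAddCommGroup HA) (_ : InnerProductSpace ℂ HA) (_ : CompleteSpace HA)
      (_ : NormedAddCommGroup HB) (_ : InnerProductSpace ℂ HB) (_ : CompleteSpace HB)
      (ρ : HilbertTensor HA HB →L[ℂ] HilbertTensor HA HB)
      (A : Fin n → HA →L[ℂ] HA) (B : Fin m → HB →L[ℂ] HB),
      IsState ρ ∧ (∀ x, IsObservable (A x)) ∧ (∀ y, IsObservable (B y)) ∧
        ∀ x y, HasTrace (ρ ∘L tensorOp (A x) (B y)) (C x y : ℂ)}

/-- The angles `θ x y = arccos (C x y)`, indexed by pairs `p = (x, y)`. -/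
def angle (C : Matrix (Fin 2) (Fin 2) ℝ) (p : Fin 2 × Fin 2) : ℝ :=
  Real.arccos (C p.1 p.2)

/-- The two sides of a double inequality `l ≤ t ≤ u`. -/
inductive Side
  | lower
  | upper

/-- The inequality on the given side of `l ≤ t ≤ u` holds with equality. -/
def IsTight (l t u : ℝ) : Side → Prop
  | Side.lower => l = t
  | Side.upper => t = u

/-- `C` saturates the given side of the cycle inequality
`0 ≤ (∑ q ≠ p, θ q) - θ p ≤ 2 π`. There are eight pairs `(p, side)`. -/
def SaturatesCycle (C : Matrix (Fin 2) (Fin 2) ℝ) (e : (Fin 2 × Fin 2) × Side) : Prop :=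
  IsTight 0 ((∑ q ∈ Finset.univ.erase e.1, angle C q) - angle C e.1) (2 * Real.pi) e.2

/-- `C` saturates the given side of the box inequality `0 ≤ θ p ≤ π`.
There are eight pairs `(p, side)`. -/
def SaturatesBox (C : Matrix (Fin 2) (Fin 2) ℝ) (e : (Fin 2 × Fin 2) × Side) : Prop :=
  IsTight 0 (angle C e.1) Real.pi e.2

end QuantumCorrelator

end

/-!
A correlator is a matrix of inner products between two families of unit vectors. One inclusion
replaces the cyclicity of the trace by a change of Hilbert basis: if `Y` is an observable, then
`Y b i` is again a Hilbert basis, so `tr (ρ X Y)` is the Gram entry of `Y` and `X` for the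
semi-inner product defined by `ρ` (`hasSum_re_inner_of_hasTrace`). The other inclusion realizes
vectors of three-dimensional space by spin operators on a maximally entangled pair of qubits
(`mem_cor_of_inElliptope`). Three dimensions suffice because the second party has only two vectors.
Together, `C` is a correlator if and only if there is a number `k`, the inner product of the two
vectors of the second party, for which both rows `(C x 0, C x 1, k)` lie in the elliptope of
positive semidefinite `3 × 3` matrices with unit diagonal (`mem_cor_iff`). For `C x y = cos θ x y`
the row `x` allows exactly the interval of `k` from `cos (θ x 0 + θ x 1)` to
`cos (θ x 0 - θ x 1)`. The cycle inequalities say that the two intervals meet, and one of them is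
tight exactly if the intervals meet in a common endpoint, lower for one row and upper for the other
(`exists_saturatesCycle_iff`).

Rank one: `C = a bᵀ` with entries of `a` and `b` in `[-1, 1]`, all such products are correlators,
and a coordinate in `(-1, 1)` can be moved in both directions, so all coordinates are `±1`.
Conversely a matrix with entries `±1` is a vertex of the cube.

Rank two: if no cycle inequality is tight, the intervals overlap in more than a point and an entry
in `(-1, 1)` can be moved alone. If two entries are `±1`, then either `C` is singular or `k` is a
free parameter along which `C` moves. Hence an extreme point has a tight cycle inequality and at
most one tight box inequality, and two tight cycle inequalities would force two tight boxes
(`eq_of_saturatesCycle`). Conversely, a tight cycle inequality determines `k` and puts both rows on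
the boundary of the elliptope. A boundary point with all coordinates in `(-1, 1)` is extreme,
because a matrix with unit diagonal is determined by a kernel vector without zero coordinates
(`InElliptope.eq_of_convexComb`). As at most one entry is `±1`, this applies to at least one row and
fixes `k`; then the other row is fixed as well (`mem_extremePoints_of_saturatesCycle`).
-/

noncomputable section

namespace QuantumCorrelator

/-! ### The three-dimensional elliptope -/

/-- The real symmetric matrix with unit diagonal and off-diagonal entries `a` (at `01`), `b`
(at `02`) and `k` (at `12`) is positive semidefinite. The condition is written as nonnegativity of
the quadratic form, so that it is visibly affine in `(a, b, k)`. -/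
def InElliptope (a b k : ℝ) : Prop :=
  ∀ x y z : ℝ, 0 ≤ x ^ 2 + y ^ 2 + z ^ 2 + 2 * (a * (x * y) + b * (x * z) + k * (y * z))

/-! ### Quantum correlators are Gram entries -/

section Operators

variable {K : Type} [NormedAddCommGroup K] [InnerProductSpace ℂ K] [CompleteSpace K]

lemma IsObservable.apply_apply {A : K →L[ℂ] K} (hA : IsObservable A) (v : K) : A (A v) = v := by
  have := congrArg (fun T : K →L[ℂ] K => T v) hA.2
  simpa [pow_two] using this

lemma IsObservable.mem_unitary {A : K →L[ℂ] K} (hA : IsObservable A) :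
    A ∈ unitary (K →L[ℂ] K) := by
  rw [Unitary.mem_iff, hA.1.star_eq, ← pow_two, hA.2]
  exact ⟨rfl, rfl⟩

/-- An observable carries Hilbert bases to Hilbert bases. -/
def IsObservable.mapBasis {A : K →L[ℂ] K} (hA : IsObservable A) {ι : Type}
    (b : HilbertBasis ι ℂ K) : HilbertBasis ι ℂ K :=
  .ofRepr ((Unitary.linearIsometryEquiv ⟨A, hA.mem_unitary⟩).symm.trans b.repr)

lemma IsObservable.mapBasis_apply {A : K →L[ℂ] K} (hA : IsObservable A) {ι : Type}
    (b : HilbertBasis ι ℂ K) (i : ι) : hA.mapBasis b i = A (b i) := by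
  classical
  rw [← HilbertBasis.repr_symm_single, ← HilbertBasis.repr_symm_single]
  rfl

lemma isObservable_one : IsObservable (1 : K →L[ℂ] K) := ⟨.one _, one_pow 2⟩

end Operators

section Tensor

variable {HA HB : Type} [NormedAddCommGroup HA] [InnerProductSpace ℂ HA]
  [NormedAddCommGroup HB] [InnerProductSpace ℂ HB]

lemma tensorOp_mul (A A' : HA →L[ℂ] HA) (B B' : HB →L[ℂ] HB) :
    tensorOp (A * A') (B * B') = tensorOp A B * tensorOp A' B' := by
  ext v
  induction v using UniformSpace.Completion.induction_on with
  | hp => exact isClosed_eq (ContinuousLinearMap.continuous _) (ContinuousLinearMap.continuous _)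
  | ih v => simp [tensorOp, TensorProduct.mapL_mul]

lemma tensorOp_one : tensorOp (1 : HA →L[ℂ] HA) (1 : HB →L[ℂ] HB) = 1 := by
  ext v
  induction v using UniformSpace.Completion.induction_on with
  | hp => exact isClosed_eq (ContinuousLinearMap.continuous _) (ContinuousLinearMap.continuous _)
  | ih v =>
    have : TensorProduct.mapL (1 : HA →L[ℂ] HA) (1 : HB →L[ℂ] HB) = 1 := TensorProduct.mapL_id_id
    simp [tensorOp, this]

variable [CompleteSpace HA] [CompleteSpace HB]

lemma isSelfAdjoint_tensorOp {A : HA →L[ℂ] HA} {B : HB →L[ℂ] HB} (hA : IsSelfAdjoint A)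
    (hB : IsSelfAdjoint B) : IsSelfAdjoint (tensorOp A B) := by
  rw [ContinuousLinearMap.isSelfAdjoint_iff_isSymmetric] at hA hB ⊢
  intro v w
  simp only [ContinuousLinearMap.coe_coe]
  induction v, w using UniformSpace.Completion.induction_on₂ with
  | hp => exact isClosed_eq (by fun_prop) (by fun_prop)
  | ih v w =>
    simp only [tensorOp, ContinuousLinearMap.completion_apply_coe,
      UniformSpace.Completion.inner_coe]
    induction v using TensorProduct.induction_on with
    | zero => simp
    | add v₁ v₂ h₁ h₂ => simp only [map_add, inner_add_left, h₁, h₂]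
    | tmul a b =>
      induction w using TensorProduct.induction_on with
      | zero => simp
      | add w₁ w₂ h₁ h₂ => simp only [map_add, inner_add_right, h₁, h₂]
      | tmul a' b' =>
        have h₁ := hA a a'
        have h₂ := hB b b'
        simp only [ContinuousLinearMap.coe_coe] at h₁ h₂
        simp [h₁, h₂]

lemma IsObservable.tensorOp {A : HA →L[ℂ] HA} {B : HB →L[ℂ] HB} (hA : IsObservable A)
    (hB : IsObservable B) : IsObservable (tensorOp A B) :=
  ⟨isSelfAdjoint_tensorOp hA.1 hB.1, by
    rw [pow_two, ← tensorOp_mul, ← pow_two, ← pow_two, hA.2, hB.2, tensorOp_one]⟩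

end Tensor

section Gram

variable {K : Type} [NormedAddCommGroup K] [InnerProductSpace ℂ K] [CompleteSpace K]

/-- Moving the basis by the observable `Y` rotates `Y` around the trace, so that `tr (ρ X Y)` is
the Gram entry of `Y` and `X` for the semi-inner product defined by `ρ`. This replaces the
cyclicity of the trace. -/
lemma hasSum_re_inner_of_hasTrace {ρ X Y : K →L[ℂ] K} (hY : IsObservable Y) {c : ℝ}
    (h : HasTrace (ρ ∘L (X * Y)) (c : ℂ)) {ι : Type} (b : HilbertBasis ι ℂ K) :
    HasSum (fun i => (⟪Y (b i), ρ (X (b i))⟫_ℂ).re) c := by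
  have := (Complex.hasSum_iff _ _).1 (h ι (hY.mapBasis b))
  simpa [hY.mapBasis_apply, hY.apply_apply] using this.1

omit [CompleteSpace K] in
lemma summable_re_inner_of_isPositive {ρ : K →L[ℂ] K} (hρ : ρ.IsPositive) {ι : Type}
    {f g : ι → K} (hf : Summable fun i => (⟪f i, ρ (f i)⟫_ℂ).re)
    (hg : Summable fun i => (⟪g i, ρ (g i)⟫_ℂ).re) :
    Summable fun i => (⟪f i, ρ (g i)⟫_ℂ).re := by
  refine Summable.of_norm_bounded (hf.add hg) fun i => ?_
  have hs : (⟪g i, ρ (f i)⟫_ℂ).re = (⟪f i, ρ (g i)⟫_ℂ).re := by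
    rw [← hρ.inner_left_eq_inner_right, ← inner_conj_symm, Complex.conj_re]
  have h₁ := hρ.re_inner_nonneg_right (f i + g i)
  have h₂ := hρ.re_inner_nonneg_right (f i - g i)
  have h₃ := hρ.re_inner_nonneg_right (f i)
  have h₄ := hρ.re_inner_nonneg_right (g i)
  simp only [map_add, map_sub, inner_add_left, inner_add_right, inner_sub_left, inner_sub_right,
    RCLike.re_to_complex] at h₁ h₂ h₃ h₄
  rw [Real.norm_eq_abs, abs_le]
  constructor <;> linarith

/-- The correlations of one observable `X` with two observables `Y₁`, `Y₂`, completed by the real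
part of `tr (Y₁ ρ Y₂)`, form a point of the elliptope. -/
lemma inElliptope_of_hasTrace {ρ X Y₁ Y₂ : K →L[ℂ] K} (hρ : IsState ρ) (hX : IsObservable X)
    (hY₁ : IsObservable Y₁) (hY₂ : IsObservable Y₂) {c₁ c₂ : ℝ}
    (h₁ : HasTrace (ρ ∘L (X * Y₁)) (c₁ : ℂ)) (h₂ : HasTrace (ρ ∘L (X * Y₂)) (c₂ : ℂ))
    {ι : Type} (b : HilbertBasis ι ℂ K) :
    InElliptope c₁ c₂ (∑' i, (⟪Y₁ (b i), ρ (Y₂ (b i))⟫_ℂ).re) := by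
  have hdiag : ∀ Z : K →L[ℂ] K, IsObservable Z →
      HasSum (fun i => (⟪Z (b i), ρ (Z (b i))⟫_ℂ).re) 1 := fun Z hZ =>
    by
    refine hasSum_re_inner_of_hasTrace hZ ?_ b
    rw [← pow_two, hZ.2, ContinuousLinearMap.one_def, ContinuousLinearMap.comp_id]
    simpa using hρ.2
  have hk := (summable_re_inner_of_isPositive hρ.1 (hdiag _ hY₁).summable
    (hdiag _ hY₂).summable).hasSum
  have hsymm : ∀ u v : K, (⟪u, ρ v⟫_ℂ).re = (⟪v, ρ u⟫_ℂ).re := fun u v => by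
    rw [← hρ.1.inner_left_eq_inner_right, ← inner_conj_symm, Complex.conj_re]
  intro x y z
  have hsum := ((((hdiag X hX).mul_left (x ^ 2)).add ((hdiag Y₁ hY₁).mul_left (y ^ 2))).add
    ((hdiag Y₂ hY₂).mul_left (z ^ 2))).add
    (((((hasSum_re_inner_of_hasTrace hY₁ h₁ b).mul_right (x * y)).add
      ((hasSum_re_inner_of_hasTrace hY₂ h₂ b).mul_right (x * z))).add
      (hk.mul_right (y * z))).mul_left 2)
  simp only [mul_one] at hsum
  refine hsum.nonneg fun i => ?_
  have hpos := hρ.1.re_inner_nonneg_right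
    ((x : ℂ) • X (b i) + (y : ℂ) • Y₁ (b i) + (z : ℂ) • Y₂ (b i))
  simp only [map_add, map_smul, inner_add_left, inner_add_right, inner_smul_left,
    inner_smul_right, Complex.conj_ofReal, RCLike.re_to_complex, Complex.add_re,
    Complex.re_ofReal_mul] at hpos
  have e₁ := hsymm (X (b i)) (Y₁ (b i))
  have e₂ := hsymm (X (b i)) (Y₂ (b i))
  have e₃ := hsymm (Y₁ (b i)) (Y₂ (b i))
  rw [e₁, e₂] at hpos
  rw [← e₃] at hpos
  linarith

end Gram

/-- The common completion `k` is the Gram entry of the two observables of the second party; it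
does not depend on the row. -/
lemma exists_inElliptope_of_mem_cor {n : ℕ} {C : Matrix (Fin n) (Fin 2) ℝ} (hC : C ∈ Cor n 2) :
    ∃ k, ∀ x, InElliptope (C x 0) (C x 1) k := by
  obtain ⟨HA, HB, _, _, _, _, _, _, ρ, A, B, hρ, hA, hB, hT⟩ := hC
  obtain ⟨w, b, -⟩ := exists_hilbertBasis ℂ (HilbertTensor HA HB)
  have key : ∀ x y, tensorOp (A x) (B y) = tensorOp (A x) 1 * tensorOp 1 (B y) := fun x y => by
    rw [← tensorOp_mul, mul_one, one_mul]
  refine ⟨_, fun x => inElliptope_of_hasTrace hρ ((hA x).tensorOp isObservable_one)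
    (isObservable_one.tensorOp (hB 0)) (isObservable_one.tensorOp (hB 1)) ?_ ?_ b⟩
  · rw [← key]; exact hT x 0
  · rw [← key]; exact hT x 1

/-! ### Membership in the elliptope -/

namespace InElliptope

variable {a b k : ℝ}

lemma symm (h : InElliptope a b k) : InElliptope b a k := fun x y z => by
  have := h x z y
  linarith

lemma cycle (h : InElliptope a b k) : InElliptope k a b := fun x y z => by
  have := h z x y
  linarith

lemma sq_le_one (h : InElliptope a b k) : a ^ 2 ≤ 1 := by
  have := h (-a) 1 0
  nlinarith

lemma sq_sub_le (h : InElliptope a b k) : (k - a * b) ^ 2 ≤ (1 - a ^ 2) * (1 - b ^ 2) := by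
  rcases h.sq_le_one.lt_or_eq with ha | ha
  · -- the last column of the adjugate matrix, where the form is `(1 - a ^ 2) * det`
    have h₁ := h (a * k - b) (a * b - k) (1 - a ^ 2)
    have h₂ : 0 ≤ (1 - a ^ 2) * ((1 - a ^ 2) * (1 - b ^ 2) - (k - a * b) ^ 2) := by
      convert! h₁ using 1
      ring
    have := nonneg_of_mul_nonneg_right h₂ (by linarith)
    linarith
  · have h₁ := h (-a) 1 (a * b - k)
    rw [ha]
    nlinarith

lemma of_sq_sub_le (ha : a ^ 2 ≤ 1) (hb : b ^ 2 ≤ 1)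
    (h : (k - a * b) ^ 2 ≤ (1 - a ^ 2) * (1 - b ^ 2)) : InElliptope a b k := by
  intro x y z
  have hp : 0 ≤ (1 - a ^ 2) * y ^ 2 := mul_nonneg (by linarith) (sq_nonneg y)
  have hr : 0 ≤ (1 - b ^ 2) * z ^ 2 := mul_nonneg (by linarith) (sq_nonneg z)
  have h₁ : (2 * (k - a * b) * (y * z)) ^ 2 ≤
      ((1 - a ^ 2) * y ^ 2 + (1 - b ^ 2) * z ^ 2) ^ 2 := by
    have := mul_le_mul_of_nonneg_right h (sq_nonneg (y * z))
    nlinarith [sq_nonneg ((1 - a ^ 2) * y ^ 2 - (1 - b ^ 2) * z ^ 2)]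
  have h₂ := (abs_le.1 (abs_le_of_sq_le_sq h₁ (by linarith))).1
  nlinarith [sq_nonneg (x + a * y + b * z)]

end InElliptope

/-! ### Realization by a maximally entangled pair of qubits -/

/-- The normalized maximally entangled vector `(e₀ ⊗ e₀ + e₁ ⊗ e₁) / √2`. -/
def bellVector : HilbertTensor (EuclideanSpace ℂ (Fin 2)) (EuclideanSpace ℂ (Fin 2)) :=
  ((√2 : ℝ) : ℂ)⁻¹ • ((∑ i : Fin 2, (EuclideanSpace.single i (1 : ℂ)) ⊗ₜ[ℂ]
    (EuclideanSpace.single i (1 : ℂ)) :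
      EuclideanSpace ℂ (Fin 2) ⊗[ℂ] EuclideanSpace ℂ (Fin 2)) :
    HilbertTensor (EuclideanSpace ℂ (Fin 2)) (EuclideanSpace ℂ (Fin 2)))

lemma inner_bellVector_tensorOp (M N : Matrix (Fin 2) (Fin 2) ℂ) :
    ⟪bellVector, tensorOp (Matrix.toEuclideanCLM (𝕜 := ℂ) M) (Matrix.toEuclideanCLM (𝕜 := ℂ) N)
      bellVector⟫_ℂ = (∑ i, ∑ j, M i j * N i j) / 2 := by
  have h2 : ((√2 : ℝ) : ℂ)⁻¹ * ((√2 : ℝ) : ℂ)⁻¹ = 1 / 2 := by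
    rw [← mul_inv, ← Complex.ofReal_mul, Real.mul_self_sqrt (by norm_num)]
    norm_num
  have hs : ∀ (M : Matrix (Fin 2) (Fin 2) ℂ) (i j : Fin 2),
      ⟪EuclideanSpace.single i (1 : ℂ),
        Matrix.toEuclideanCLM (𝕜 := ℂ) M (EuclideanSpace.single j 1)⟫_ℂ = M i j := fun M i j => by
    simp [EuclideanSpace.inner_single_left]
  rw [bellVector, map_smul, inner_smul_left, inner_smul_right, tensorOp,
    ContinuousLinearMap.completion_apply_coe, UniformSpace.Completion.inner_coe, ← mul_assoc,
    map_inv₀, Complex.conj_ofReal, h2, map_sum]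
  simp only [sum_inner, inner_sum, TensorProduct.mapL_tmul, TensorProduct.inner_tmul, hs]
  rw [Finset.sum_comm, one_div, mul_comm, div_eq_mul_inv]

lemma norm_bellVector : ‖bellVector‖ = 1 := by
  have h := inner_bellVector_tensorOp 1 1
  rw [map_one, tensorOp_one, one_apply_eq_self] at h
  have h1 : ⟪bellVector, bellVector⟫_ℂ = 1 := by
    rw [h]
    simp [Fin.sum_univ_two]
  have h2 : ‖bellVector‖ ^ 2 = 1 := by
    rw [← inner_self_eq_norm_sq (𝕜 := ℂ), h1, RCLike.one_re]
  exact (pow_eq_one_iff_of_nonneg (norm_nonneg _) two_ne_zero).1 h2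

section RankOne

variable {K : Type} [NormedAddCommGroup K] [InnerProductSpace ℂ K] [CompleteSpace K]

lemma hasTrace_rankOne_comp (v : K) (T : K →L[ℂ] K) :
    HasTrace (InnerProductSpace.rankOne ℂ v v ∘L T) ⟪v, T v⟫_ℂ := by
  intro ι b
  have h := b.hasSum_inner_mul_inner (ContinuousLinearMap.adjoint T v) v
  simpa [ContinuousLinearMap.adjoint_inner_left, inner_smul_right] using h

lemma isState_rankOne {v : K} (hv : ‖v‖ = 1) : IsState (InnerProductSpace.rankOne ℂ v v) := by
  refine ⟨.of_isStarProjection (InnerProductSpace.isStarProjection_rankOne_self hv), ?_⟩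
  have h := hasTrace_rankOne_comp v (.id ℂ K)
  rwa [ContinuousLinearMap.comp_id, ContinuousLinearMap.id_apply, inner_self_eq_norm_sq_to_K, hv,
    RCLike.ofReal_one, one_pow] at h

end RankOne

/-- The spin operator `p σ_z + q σ_x + r σ_y` in the direction `(p, q, r)`. -/
def spin (p q r : ℝ) : Matrix (Fin 2) (Fin 2) ℂ :=
  !![(p : ℂ), q - r * Complex.I; q + r * Complex.I, -p]

lemma isObservable_spin {p q r : ℝ} (h : p ^ 2 + q ^ 2 + r ^ 2 = 1) :
    IsObservable (Matrix.toEuclideanCLM (𝕜 := ℂ) (spin p q r)) := by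
  have hs : star (spin p q r) = spin p q r := by
    ext i j
    fin_cases i <;> fin_cases j <;>
      simp [spin, Matrix.star_apply, sub_eq_add_neg]
  have hsq : spin p q r ^ 2 = 1 := by
    have h' : (p : ℂ) ^ 2 + q ^ 2 + r ^ 2 = 1 := by exact_mod_cast h
    have hI := Complex.I_sq
    ext i j
    fin_cases i <;> fin_cases j <;>
      simp [spin, pow_two, Matrix.mul_apply, Fin.sum_univ_two]
    · linear_combination h' - (r : ℂ) ^ 2 * hI
    · ring
    · ring
    · linear_combination h' - (r : ℂ) ^ 2 * hI
  exact ⟨by rw [IsSelfAdjoint, ← map_star, hs], by rw [← map_pow, hsq, map_one]⟩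

/-- The two vectors of the second party span a plane. The vectors of the first party only matter
through their projections to it, so a third direction is enough to make them unit vectors, and
the spin operators of one qubit realize all these vectors. -/
lemma mem_cor_of_inElliptope {n : ℕ} {C : Matrix (Fin n) (Fin 2) ℝ} {k : ℝ}
    (h : ∀ x, InElliptope (C x 0) (C x 1) k) (hk : k ^ 2 ≤ 1) : C ∈ Cor n 2 := by
  set s := √(1 - k ^ 2) with hs
  have hs2 : s ^ 2 = 1 - k ^ 2 := Real.sq_sqrt (by linarith)
  -- if `s = 0`, then `C x 1 = k * C x 0` and the second coordinate `0 / 0 = 0` is the right one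
  set q : Fin n → ℝ := fun x => (C x 1 - k * C x 0) / s with hq
  have hqs : ∀ x, q x * s = C x 1 - k * C x 0 := fun x => by
    rcases eq_or_ne s 0 with h0 | h0
    · have := (h x).cycle.sq_sub_le
      rw [← hs2, h0] at this
      rw [h0, mul_zero, eq_comm, ← sq_eq_zero_iff]
      nlinarith [sq_nonneg (C x 1 - k * C x 0)]
    · simp only [hq]
      field_simp
  have hle : ∀ x, C x 0 ^ 2 + q x ^ 2 ≤ 1 := fun x => by
    have h0 := (h x).sq_le_one
    rcases eq_or_ne s 0 with hs0 | hs0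
    · have : q x = 0 := by simp [hq, hs0]
      rw [this]; linarith
    · have h1 := (h x).cycle.sq_sub_le
      rw [← hqs x, ← hs2] at h1
      have hpos : 0 < s ^ 2 := by positivity
      have : s ^ 2 * (q x ^ 2) ≤ s ^ 2 * (1 - C x 0 ^ 2) := by linarith
      linarith [le_of_mul_le_mul_left this hpos]
  refine ⟨EuclideanSpace ℂ (Fin 2), EuclideanSpace ℂ (Fin 2), inferInstance, inferInstance,
    inferInstance, inferInstance, inferInstance, inferInstance,
    InnerProductSpace.rankOne ℂ bellVector bellVector,
    fun x => Matrix.toEuclideanCLM (𝕜 := ℂ) (spin (C x 0) (q x) √(1 - (C x 0 ^ 2 + q x ^ 2))),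
    ![Matrix.toEuclideanCLM (𝕜 := ℂ) (spin 1 0 0), Matrix.toEuclideanCLM (𝕜 := ℂ) (spin k s 0)],
    isState_rankOne norm_bellVector, fun x => isObservable_spin ?_,
    Fin.forall_fin_two.2 ⟨isObservable_spin (by norm_num), isObservable_spin ?_⟩,
    fun x => Fin.forall_fin_two.2 ⟨?_, ?_⟩⟩
  · rw [Real.sq_sqrt (by linarith [hle x])]; ring
  · rw [hs2]; ring
  · convert! hasTrace_rankOne_comp bellVector _ using 1
    rw [Matrix.cons_val_zero, inner_bellVector_tensorOp]
    simp [spin, Fin.sum_univ_two]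
  · have hqs' : (q x : ℂ) * s = C x 1 - k * C x 0 := by exact_mod_cast hqs x
    convert! hasTrace_rankOne_comp bellVector _ using 1
    rw [Matrix.cons_val_one, Matrix.cons_val_fin_one, inner_bellVector_tensorOp]
    simp [spin, Fin.sum_univ_two]
    linear_combination (-1 : ℂ) * hqs'

lemma mem_cor_iff {C : Matrix (Fin 2) (Fin 2) ℝ} :
    C ∈ Cor 2 2 ↔ ∃ k, ∀ x, InElliptope (C x 0) (C x 1) k :=
  ⟨exists_inElliptope_of_mem_cor, fun ⟨_, hk⟩ =>
    mem_cor_of_inElliptope hk (hk 0).cycle.sq_le_one⟩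

/-! ### Extreme points of the three-dimensional elliptope -/

namespace InElliptope

variable {a b k : ℝ}

lemma abs_sub_le (h : InElliptope a b k) : |k - a * b| ≤ √(1 - a ^ 2) * √(1 - b ^ 2) := by
  rw [← Real.sqrt_mul (by linarith [h.sq_le_one])]
  exact Real.abs_le_sqrt h.sq_sub_le

lemma of_abs_sub_le (ha : a ^ 2 ≤ 1) (hb : b ^ 2 ≤ 1)
    (h : |k - a * b| ≤ √(1 - a ^ 2) * √(1 - b ^ 2)) : InElliptope a b k := by
  refine of_sq_sub_le ha hb ?_
  rw [← Real.sqrt_mul (by linarith)] at h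
  have := (Real.le_sqrt (abs_nonneg _)
    (mul_nonneg (sub_nonneg.2 ha) (sub_nonneg.2 hb))).1 h
  rwa [sq_abs] at this

lemma eq_mul_of_sq_eq_one (h : InElliptope a b k) (ha : a ^ 2 = 1) : b = a * k := by
  have h1 := h.sq_sub_le
  rw [ha, sub_self, zero_mul] at h1
  have h2 : k - a * b = 0 := by nlinarith [sq_nonneg (k - a * b)]
  linear_combination -a * h2 - b * ha

lemma convexComb {a₁ b₁ k₁ a₂ b₂ k₂ t u : ℝ} (h₁ : InElliptope a₁ b₁ k₁)
    (h₂ : InElliptope a₂ b₂ k₂) (ht : 0 ≤ t) (hu : 0 ≤ u) (htu : t + u = 1) :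
    InElliptope (t * a₁ + u * a₂) (t * b₁ + u * b₂) (t * k₁ + u * k₂) := fun x y z => by
  have e₁ := mul_nonneg ht (h₁ x y z)
  have e₂ := mul_nonneg hu (h₂ x y z)
  have : x ^ 2 + y ^ 2 + z ^ 2 = (t + u) * (x ^ 2 + y ^ 2 + z ^ 2) := by rw [htu, one_mul]
  rw [this]
  linarith

/-- An isotropic vector of a positive semidefinite matrix is in its kernel. -/
lemma kernel_of_isotropic (h : InElliptope a b k) {x y z : ℝ}
    (h0 : x ^ 2 + y ^ 2 + z ^ 2 + 2 * (a * (x * y) + b * (x * z) + k * (y * z)) = 0) :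
    x + a * y + b * z = 0 ∧ a * x + y + k * z = 0 ∧ b * x + k * y + z = 0 := by
  have h1 := h (x - (x + a * y + b * z)) y z
  have h2 := h x (y - (a * x + y + k * z)) z
  have h3 := h x y (z - (b * x + k * y + z))
  refine ⟨?_, ?_, ?_⟩ <;> rw [← sq_eq_zero_iff] <;> refine le_antisymm ?_ (sq_nonneg _)
  · linarith
  · linarith
  · linarith

/-- A boundary point of the elliptope whose three coordinates are in the open interval `(-1, 1)`
is extreme: the kernel of its matrix is spanned by a vector without zero coordinates, and a matrix
with unit diagonal is determined by such a kernel vector. -/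
lemma eq_of_convexComb {a₁ b₁ k₁ a₂ b₂ k₂ t u : ℝ} (h₁ : InElliptope a₁ b₁ k₁)
    (h₂ : InElliptope a₂ b₂ k₂) (ht : 0 < t) (hu : 0 < u) (htu : t + u = 1)
    (ha : t * a₁ + u * a₂ = a) (hb : t * b₁ + u * b₂ = b) (hk : t * k₁ + u * k₂ = k)
    (ha1 : a ^ 2 < 1) (hb1 : b ^ 2 < 1) (hk1 : k ^ 2 < 1)
    (hdet : (k - a * b) ^ 2 = (1 - a ^ 2) * (1 - b ^ 2)) : a₁ = a ∧ b₁ = b ∧ k₁ = k := by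
  have h : InElliptope a b k := by
    rw [← ha, ← hb, ← hk]; exact h₁.convexComb h₂ ht.le hu.le htu
  -- the last column of the adjugate matrix
  obtain ⟨x, hx⟩ : ∃ x, x = a * k - b := ⟨_, rfl⟩
  obtain ⟨y, hy⟩ : ∃ y, y = a * b - k := ⟨_, rfl⟩
  obtain ⟨z, hz⟩ : ∃ z, z = 1 - a ^ 2 := ⟨_, rfl⟩
  have hz0 : z ≠ 0 := by rw [hz]; linarith
  have hy0 : y ≠ 0 := by
    have : y ^ 2 ≠ 0 := by
      rw [hy, ← neg_sq, neg_sub, hdet]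
      exact mul_ne_zero (by linarith) (by linarith)
    exact fun h0 => this (by rw [h0]; ring)
  have hx0 : x ≠ 0 := by
    have h3 : x ^ 2 = (1 - a ^ 2) * (1 - k ^ 2) := by rw [hx]; linear_combination hdet
    have : x ^ 2 ≠ 0 := by
      rw [h3]
      exact mul_ne_zero (by linarith) (by linarith)
    exact fun h0 => this (by rw [h0]; ring)
  have h0 : x ^ 2 + y ^ 2 + z ^ 2 + 2 * (a * (x * y) + b * (x * z) + k * (y * z)) = 0 := by
    rw [hx, hy, hz]; linear_combination (a ^ 2 - 1) * hdet
  have h0₁ : x ^ 2 + y ^ 2 + z ^ 2 + 2 * (a₁ * (x * y) + b₁ * (x * z) + k₁ * (y * z)) = 0 := by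
    have e₁ := h₁ x y z
    have e₂ := mul_nonneg hu.le (h₂ x y z)
    refine le_antisymm (le_of_mul_le_mul_left ?_ ht) e₁
    have hu' : u = 1 - t := by linarith
    rw [← ha, ← hb, ← hk] at h0
    rw [hu'] at e₂ h0
    linarith
  obtain ⟨p, q, r⟩ := h.kernel_of_isotropic h0
  obtain ⟨p₁, q₁, r₁⟩ := h₁.kernel_of_isotropic h0₁
  have hA : (a₁ - a) * (2 * (x * y)) = 0 := by
    linear_combination x * (p₁ - p) + y * (q₁ - q) - z * (r₁ - r)
  have hB : (b₁ - b) * (2 * (x * z)) = 0 := by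
    linear_combination x * (p₁ - p) - y * (q₁ - q) + z * (r₁ - r)
  have hK : (k₁ - k) * (2 * (y * z)) = 0 := by
    linear_combination - x * (p₁ - p) + y * (q₁ - q) + z * (r₁ - r)
  refine ⟨sub_eq_zero.1 ?_, sub_eq_zero.1 ?_, sub_eq_zero.1 ?_⟩
  · simpa [hx0, hy0] using hA
  · simpa [hx0, hz0] using hB
  · simpa [hy0, hz0] using hK

end InElliptope

lemma eq_of_convexComb_of_sq_eq_one {a a₁ a₂ t u : ℝ} (h₁ : a₁ ^ 2 ≤ 1) (h₂ : a₂ ^ 2 ≤ 1)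
    (ht : 0 < t) (hu : 0 < u) (htu : t + u = 1) (ha : t * a₁ + u * a₂ = a) (ha1 : a ^ 2 = 1) :
    a₁ = a := by
  obtain ⟨l₁, g₁⟩ := abs_le.1 ((sq_le_one_iff_abs_le_one _).1 h₁)
  obtain ⟨l₂, g₂⟩ := abs_le.1 ((sq_le_one_iff_abs_le_one _).1 h₂)
  rcases sq_eq_one_iff.1 ha1 with rfl | rfl
  · nlinarith
  · nlinarith

/-! ### Entrywise description of the correlator set -/

lemma sq_le_one_of_mem_cor {C : Matrix (Fin 2) (Fin 2) ℝ} (hC : C ∈ Cor 2 2) (x y : Fin 2) :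
    C x y ^ 2 ≤ 1 := by
  obtain ⟨k, hk⟩ := mem_cor_iff.1 hC
  revert y
  exact Fin.forall_fin_two.2 ⟨(hk x).sq_le_one, (hk x).symm.sq_le_one⟩

/-- The two intervals of admissible completions `k`, one for each row, intersect. -/
lemma mem_cor_of_abs_sub_le {C : Matrix (Fin 2) (Fin 2) ℝ} (h1 : ∀ x y, C x y ^ 2 ≤ 1)
    (h : |C 0 0 * C 0 1 - C 1 0 * C 1 1| ≤
      √(1 - C 0 0 ^ 2) * √(1 - C 0 1 ^ 2) + √(1 - C 1 0 ^ 2) * √(1 - C 1 1 ^ 2)) :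
    C ∈ Cor 2 2 := by
  rw [abs_le] at h
  have hs : ∀ x, 0 ≤ √(1 - C x 0 ^ 2) * √(1 - C x 1 ^ 2) := fun x => by positivity
  set l : Fin 2 → ℝ := fun x => C x 0 * C x 1 - √(1 - C x 0 ^ 2) * √(1 - C x 1 ^ 2) with hl
  refine mem_cor_iff.2 ⟨max (l 0) (l 1), Fin.forall_fin_two.2
    ⟨.of_abs_sub_le (h1 _ _) (h1 _ _) (abs_le.2 ⟨?_, ?_⟩),
      .of_abs_sub_le (h1 _ _) (h1 _ _) (abs_le.2 ⟨?_, ?_⟩)⟩⟩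
  · have : l 0 ≤ max (l 0) (l 1) := le_max_left _ _
    simp only [hl] at this ⊢
    linarith
  · rw [sub_le_iff_le_add]
    refine max_le ?_ ?_ <;> simp only [hl] <;> linarith [hs 0]
  · have : l 1 ≤ max (l 0) (l 1) := le_max_right _ _
    simp only [hl] at this ⊢
    linarith
  · rw [sub_le_iff_le_add]
    refine max_le ?_ ?_ <;> simp only [hl] <;> linarith [hs 1]

lemma eq_zero_of_mem_extremePoints {E : Type*} [AddCommGroup E] [Module ℝ E] {S : Set E} {v d : E}
    (hv : v ∈ S.extremePoints ℝ) (h₁ : v + d ∈ S) (h₂ : v - d ∈ S) : d = 0 := by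
  have := hv.2 h₁ h₂ ⟨1 / 2, 1 / 2, by norm_num, by norm_num, by norm_num, by module⟩
  simpa using this

/-! ### Angles -/

lemma angle_mem (C : Matrix (Fin 2) (Fin 2) ℝ) (p : Fin 2 × Fin 2) :
    0 ≤ angle C p ∧ angle C p ≤ Real.pi :=
  ⟨Real.arccos_nonneg _, Real.arccos_le_pi _⟩

lemma saturatesCycle_iff (C : Matrix (Fin 2) (Fin 2) ℝ) (p : Fin 2 × Fin 2) (s : Side) :
    SaturatesCycle C (p, s) ↔
      IsTight 0 ((∑ q, angle C q) - 2 * angle C p) (2 * Real.pi) s := by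
  rw [SaturatesCycle, Finset.sum_erase_eq_sub (Finset.mem_univ p), sub_sub,
    ← two_mul (angle C p)]

lemma sum_angle (C : Matrix (Fin 2) (Fin 2) ℝ) :
    ∑ q, angle C q = angle C (0, 0) + angle C (0, 1) + (angle C (1, 0) + angle C (1, 1)) := by
  simp [Fintype.sum_prod_type, Fin.sum_univ_two]

lemma exists_saturatesBox_iff {C : Matrix (Fin 2) (Fin 2) ℝ} (h : ∀ x y, C x y ^ 2 ≤ 1)
    (p : Fin 2 × Fin 2) : (∃ s, SaturatesBox C (p, s)) ↔ C p.1 p.2 ^ 2 = 1 := by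
  obtain ⟨l, g⟩ := abs_le.1 ((sq_le_one_iff_abs_le_one _).1 (h p.1 p.2))
  rw [sq_eq_one_iff]
  constructor
  · rintro ⟨_ | _, hs⟩
    · exact Or.inl (le_antisymm g (Real.arccos_eq_zero.1 (Eq.symm hs)))
    · exact Or.inr (le_antisymm (Real.arccos_eq_pi.1 hs) l)
  · rintro (h | h)
    · exact ⟨.lower, (Real.arccos_eq_zero.2 h.ge).symm⟩
    · exact ⟨.upper, Real.arccos_eq_pi.2 h.le⟩

lemma subsingleton_saturatesBox_iff {C : Matrix (Fin 2) (Fin 2) ℝ} (h : ∀ x y, C x y ^ 2 ≤ 1) :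
    {e | SaturatesBox C e}.Subsingleton ↔
      ∀ p q : Fin 2 × Fin 2, C p.1 p.2 ^ 2 = 1 → C q.1 q.2 ^ 2 = 1 → p = q := by
  constructor
  · intro hS p q hp hq
    obtain ⟨s, hs⟩ := (exists_saturatesBox_iff h p).2 hp
    obtain ⟨s', hs'⟩ := (exists_saturatesBox_iff h q).2 hq
    exact congrArg Prod.fst (hS hs hs')
  · rintro hS ⟨p, s⟩ hs ⟨q, s'⟩ hs'
    obtain rfl := hS p q ((exists_saturatesBox_iff h p).1 ⟨s, hs⟩)
      ((exists_saturatesBox_iff h q).1 ⟨s', hs'⟩)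
    have hpi := Real.pi_pos
    rcases s <;> rcases s' <;> first
    | rfl
    | (simp only [Set.mem_ofPred_eq, SaturatesBox, IsTight] at hs hs'; linarith)

/-- Two different tight cycle inequalities force two tight box inequalities at different places. -/
lemma eq_of_saturatesCycle {C : Matrix (Fin 2) (Fin 2) ℝ}
    (hbox : ∀ p q s s', SaturatesBox C (p, s) → SaturatesBox C (q, s') → p = q)
    {e e' : (Fin 2 × Fin 2) × Side} (he : SaturatesCycle C e) (he' : SaturatesCycle C e') :
    e = e' := by
  have hpi := Real.pi_pos
  obtain ⟨p, s⟩ := e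
  obtain ⟨q, s'⟩ := e'
  rw [saturatesCycle_iff] at he he'
  by_cases hpq : p = q
  · subst hpq
    rcases s <;> rcases s' <;> first | rfl | (simp only [IsTight] at he he'; linarith)
  exfalso
  obtain ⟨r, r', hr, hu⟩ : ∃ r r' : Fin 2 × Fin 2, r ≠ r' ∧
      (Finset.univ : Finset (Fin 2 × Fin 2)).val = {p, q, r, r'} := by
    clear he he'
    revert p q; decide
  have hsum : ∑ i, angle C i = angle C p + (angle C q + (angle C r + angle C r')) := by
    rw [Finset.sum, hu]; simp
  have bp := angle_mem C p
  have bq := angle_mem C q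
  have br := angle_mem C r
  have br' := angle_mem C r'
  rcases s <;> rcases s' <;> simp only [IsTight, hsum] at he he'
  · exact hr (hbox r r' .lower .lower (show 0 = angle C r by linarith)
      (show 0 = angle C r' by linarith))
  · exact hpq (hbox p q .upper .lower (show angle C p = Real.pi by linarith)
      (show 0 = angle C q by linarith))
  · exact hpq (hbox p q .lower .upper (show 0 = angle C p by linarith)
      (show angle C q = Real.pi by linarith))
  · exact hr (hbox r r' .upper .upper (show angle C r = Real.pi by linarith)
      (show angle C r' = Real.pi by linarith))

lemma eq_or_eq_of_cos_eq_cos {s d : ℝ} (hs : 0 ≤ s) (hs' : s ≤ 2 * Real.pi) (hd : |d| ≤ Real.pi)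
    (h : Real.cos s = Real.cos d) :
    s = d ∨ s = -d ∨ s = 2 * Real.pi + d ∨ s = 2 * Real.pi - d := by
  rw [← Real.cos_abs d] at h
  have hd' : |d| ∈ Set.Icc 0 Real.pi := ⟨abs_nonneg d, hd⟩
  rcases le_total s Real.pi with hsp | hsp
  · have := Real.injOn_cos ⟨hs, hsp⟩ hd' h
    rcases abs_choice d with e | e <;> rw [e] at this <;> simp [this]
  · rw [← Real.cos_two_pi_sub] at h
    have := Real.injOn_cos ⟨by linarith, by linarith⟩ hd' h
    rcases abs_choice d with e | e <;> rw [e] at this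
    · exact Or.inr (Or.inr (Or.inr (by linarith)))
    · exact Or.inr (Or.inr (Or.inl (by linarith)))

/-- A cycle inequality is tight exactly if the sum of the two angles of one row has the same cosine
as the difference of the two angles of the other row. -/
lemma exists_saturatesCycle_iff_cos (C : Matrix (Fin 2) (Fin 2) ℝ) :
    (∃ e, SaturatesCycle C e) ↔
      Real.cos (angle C (0, 0) + angle C (0, 1)) = Real.cos (angle C (1, 0) - angle C (1, 1)) ∨
      Real.cos (angle C (1, 0) + angle C (1, 1)) = Real.cos (angle C (0, 0) - angle C (0, 1)) := by
  constructor
  · rintro ⟨⟨⟨i, j⟩, s⟩, he⟩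
    rw [saturatesCycle_iff, sum_angle] at he
    have main : ∀ {σ δ : ℝ}, σ = δ ∨ σ = -δ ∨ σ = 2 * Real.pi + δ ∨ σ = 2 * Real.pi - δ →
        Real.cos σ = Real.cos δ := by
      rintro σ δ (rfl | rfl | rfl | rfl)
      · rfl
      · rw [Real.cos_neg]
      · rw [add_comm, Real.cos_add_two_pi]
      · rw [Real.cos_two_pi_sub]
    fin_cases i <;> fin_cases j <;> rcases s <;> simp [IsTight] at he
    · exact Or.inr (main (Or.inl (by linarith)))
    · exact Or.inr (main (Or.inr (Or.inr (Or.inl (by linarith)))))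
    · exact Or.inr (main (Or.inr (Or.inl (by linarith))))
    · exact Or.inr (main (Or.inr (Or.inr (Or.inr (by linarith)))))
    · exact Or.inl (main (Or.inl (by linarith)))
    · exact Or.inl (main (Or.inr (Or.inr (Or.inl (by linarith)))))
    · exact Or.inl (main (Or.inr (Or.inl (by linarith))))
    · exact Or.inl (main (Or.inr (Or.inr (Or.inr (by linarith)))))
  · have b₁ := angle_mem C (0, 0)
    have b₂ := angle_mem C (0, 1)
    have b₃ := angle_mem C (1, 0)
    have b₄ := angle_mem C (1, 1)
    rintro (h | h)
    · rcases eq_or_eq_of_cos_eq_cos (by linarith) (by linarith)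
        (abs_le.2 ⟨by linarith, by linarith⟩) h with h | h | h | h
      · refine ⟨((1, 0), .lower), ?_⟩
        rw [saturatesCycle_iff, sum_angle, IsTight]; linarith
      · refine ⟨((1, 1), .lower), ?_⟩
        rw [saturatesCycle_iff, sum_angle, IsTight]; linarith
      · refine ⟨((1, 0), .upper), ?_⟩
        rw [saturatesCycle_iff, sum_angle, IsTight]; linarith
      · refine ⟨((1, 1), .upper), ?_⟩
        rw [saturatesCycle_iff, sum_angle, IsTight]; linarith
    · rcases eq_or_eq_of_cos_eq_cos (by linarith) (by linarith)
        (abs_le.2 ⟨by linarith, by linarith⟩) h with h | h | h | h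
      · refine ⟨((0, 0), .lower), ?_⟩
        rw [saturatesCycle_iff, sum_angle, IsTight]; linarith
      · refine ⟨((0, 1), .lower), ?_⟩
        rw [saturatesCycle_iff, sum_angle, IsTight]; linarith
      · refine ⟨((0, 0), .upper), ?_⟩
        rw [saturatesCycle_iff, sum_angle, IsTight]; linarith
      · refine ⟨((0, 1), .upper), ?_⟩
        rw [saturatesCycle_iff, sum_angle, IsTight]; linarith

/-- Tightness of a cycle inequality in terms of the matrix entries: the intervals of admissible
completions of the two rows have a common endpoint, the lower one of one row and the upper one of
the other. -/
lemma exists_saturatesCycle_iff {C : Matrix (Fin 2) (Fin 2) ℝ} (h : ∀ x y, C x y ^ 2 ≤ 1) :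
    (∃ e, SaturatesCycle C e) ↔
      C 0 0 * C 0 1 - √(1 - C 0 0 ^ 2) * √(1 - C 0 1 ^ 2) =
        C 1 0 * C 1 1 + √(1 - C 1 0 ^ 2) * √(1 - C 1 1 ^ 2) ∨
      C 1 0 * C 1 1 - √(1 - C 1 0 ^ 2) * √(1 - C 1 1 ^ 2) =
        C 0 0 * C 0 1 + √(1 - C 0 0 ^ 2) * √(1 - C 0 1 ^ 2) := by
  have hcos : ∀ x y, Real.cos (angle C (x, y)) = C x y := fun x y => by
    obtain ⟨l, g⟩ := abs_le.1 ((sq_le_one_iff_abs_le_one _).1 (h x y))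
    exact Real.cos_arccos l g
  have hsin : ∀ x y, Real.sin (angle C (x, y)) = √(1 - C x y ^ 2) := fun x y =>
    Real.sin_arccos _
  simp only [exists_saturatesCycle_iff_cos, Real.cos_add, Real.cos_sub, hcos, hsin]

/-! ### Correlators of rank one -/

/-- The witness is the completion `k = b 0 * b 1`, for which the quadratic form is the square
`(a x + b₀ y + b₁ z) ^ 2` plus a nonnegative diagonal form. -/
lemma vecMulVec_mem_cor {a b : Fin 2 → ℝ} (ha : ∀ i, a i ^ 2 ≤ 1) (hb : ∀ j, b j ^ 2 ≤ 1) :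
    Matrix.vecMulVec a b ∈ Cor 2 2 := by
  refine mem_cor_iff.2 ⟨b 0 * b 1, fun i x y z => ?_⟩
  have h₁ := mul_nonneg (sub_nonneg.2 (ha i)) (sq_nonneg x)
  have h₂ := mul_nonneg (sub_nonneg.2 (hb 0)) (sq_nonneg y)
  have h₃ := mul_nonneg (sub_nonneg.2 (hb 1)) (sq_nonneg z)
  simp only [Matrix.vecMulVec_apply]
  linarith [sq_nonneg (a i * x + b 0 * y + b 1 * z)]

/-- A singular matrix with entries in `[-1, 1]` is a product of two vectors with entries in
`[-1, 1]`. -/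
lemma exists_eq_vecMulVec_of_det_eq_zero {C : Matrix (Fin 2) (Fin 2) ℝ}
    (h1 : ∀ x y, C x y ^ 2 ≤ 1) (hdet : C.det = 0) :
    ∃ a b : Fin 2 → ℝ, (∀ i, a i ^ 2 ≤ 1) ∧ (∀ j, b j ^ 2 ≤ 1) ∧ C = Matrix.vecMulVec a b := by
  -- dividing by an entry of maximal modulus keeps the first factor in `[-1, 1]`
  obtain ⟨⟨i, j⟩, hij⟩ := Finite.exists_max fun p : Fin 2 × Fin 2 => C p.1 p.2 ^ 2
  rcases eq_or_ne (C i j) 0 with h0 | h0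
  · refine ⟨0, 0, by simp, by simp, ?_⟩
    ext x y
    have := hij (x, y)
    simp only [h0] at this
    simpa using le_antisymm (this.trans (by norm_num)) (sq_nonneg (C x y))
  · refine ⟨fun x => C x j / C i j, fun y => C i y, fun x => ?_, fun y => h1 i y, ?_⟩
    · rw [div_pow, div_le_one (by positivity)]
      exact hij (x, j)
    · have hmin : ∀ x y, C x y * C i j = C x j * C i y := by
        rw [Matrix.det_fin_two] at hdet
        intro x y
        fin_cases x <;> fin_cases y <;> fin_cases i <;> fin_cases j <;> simp <;> linarith
      ext x y
      rw [Matrix.vecMulVec_apply, div_mul_eq_mul_div, eq_div_iff h0, hmin]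

/-- If a coordinate of one factor lies in `(-1, 1)`, then the product can be moved along it. -/
lemma sq_eq_one_of_vecMulVec_mem_extremePoints {a b : Fin 2 → ℝ} (ha : ∀ i, a i ^ 2 ≤ 1)
    (hb : ∀ j, b j ^ 2 ≤ 1) (h0 : Matrix.vecMulVec a b ≠ 0)
    (h : Matrix.vecMulVec a b ∈ (Cor 2 2).extremePoints ℝ) :
    (∀ i, a i ^ 2 = 1) ∧ ∀ j, b j ^ 2 = 1 := by
  have hupd : ∀ c : Fin 2 → ℝ, (∀ i, c i ^ 2 ≤ 1) → ∀ i, c i ^ 2 ≠ 1 →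
      ∃ ε : ℝ, ε ≠ 0 ∧ (∀ i', (c + Pi.single i ε : Fin 2 → ℝ) i' ^ 2 ≤ 1) ∧
        ∀ i', (c - Pi.single i ε : Fin 2 → ℝ) i' ^ 2 ≤ 1 := by
    intro c hc i hi
    have hlt : |c i| < 1 :=
      (sq_lt_one_iff_abs_lt_one _).1 (lt_of_le_of_ne (hc i) hi)
    obtain ⟨l, g⟩ := abs_le.1 (le_refl |c i|)
    refine ⟨1 - |c i|, by linarith, fun i' => ?_, fun i' => ?_⟩ <;>
    · rcases eq_or_ne i' i with rfl | hne
      · rw [sq_le_one_iff_abs_le_one, abs_le]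
        simp only [Pi.add_apply, Pi.sub_apply, Pi.single_eq_same]
        constructor <;> linarith
      · simpa [hne] using hc i'
  constructor
  · by_contra! hne
    obtain ⟨i, hi⟩ := hne
    obtain ⟨ε, hε, h₁, h₂⟩ := hupd a ha i hi
    have hd := eq_zero_of_mem_extremePoints (d := Matrix.vecMulVec (Pi.single i ε) b) h
      (by rw [← Matrix.add_vecMulVec]; exact vecMulVec_mem_cor h₁ hb)
      (by rw [← Matrix.sub_vecMulVec]; exact vecMulVec_mem_cor h₂ hb)
    apply h0
    ext x y
    have := congrFun (congrFun hd i) y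
    simp only [Matrix.vecMulVec_apply, Pi.single_eq_same, Matrix.zero_apply, mul_eq_zero,
      hε, false_or] at this
    simp [Matrix.vecMulVec_apply, this]
  · by_contra! hne
    obtain ⟨j, hj⟩ := hne
    obtain ⟨ε, hε, h₁, h₂⟩ := hupd b hb j hj
    have hd := eq_zero_of_mem_extremePoints (d := Matrix.vecMulVec a (Pi.single j ε)) h
      (by rw [← Matrix.vecMulVec_add]; exact vecMulVec_mem_cor ha h₁)
      (by rw [← Matrix.vecMulVec_sub]; exact vecMulVec_mem_cor ha h₂)
    apply h0
    ext x y
    have := congrFun (congrFun hd x) j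
    simp only [Matrix.vecMulVec_apply, Pi.single_eq_same, Matrix.zero_apply, mul_eq_zero,
      hε, or_false] at this
    simp [Matrix.vecMulVec_apply, this]

/-- A correlator with all entries `±1` is extreme, because it is a vertex of the cube. -/
lemma mem_extremePoints_of_sq_eq_one {C : Matrix (Fin 2) (Fin 2) ℝ} (hC : C ∈ Cor 2 2)
    (h : ∀ x y, C x y ^ 2 = 1) : C ∈ (Cor 2 2).extremePoints ℝ := by
  refine ⟨hC, fun D₁ h₁ D₂ h₂ => ?_⟩
  rintro ⟨t, u, ht, hu, htu, hD⟩
  ext x y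
  exact eq_of_convexComb_of_sq_eq_one (sq_le_one_of_mem_cor h₁ x y) (sq_le_one_of_mem_cor h₂ x y)
    ht hu htu (by rw [← hD]; simp) (h x y)

lemma mem_extremePoints_iff_of_rank_eq_one {C : Matrix (Fin 2) (Fin 2) ℝ} (hC : C ∈ Cor 2 2)
    (hr : C.rank = 1) :
    C ∈ (Cor 2 2).extremePoints ℝ ↔
      ∃ x y : Fin 2 → ℝ, (∀ i, x i = 1 ∨ x i = -1) ∧ (∀ j, y j = 1 ∨ y j = -1) ∧
        C = Matrix.vecMulVec x y := by
  constructor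
  · intro h
    have hdet : C.det = 0 := by
      by_contra hne
      have := Matrix.rank_of_isUnit C
        ((Matrix.isUnit_iff_isUnit_det C).2 (isUnit_iff_ne_zero.2 hne))
      rw [hr] at this
      simp at this
    obtain ⟨a, b, ha, hb, rfl⟩ :=
      exists_eq_vecMulVec_of_det_eq_zero (sq_le_one_of_mem_cor hC) hdet
    have h0 : Matrix.vecMulVec a b ≠ 0 := fun h0 => by simp [h0] at hr
    obtain ⟨h₁, h₂⟩ := sq_eq_one_of_vecMulVec_mem_extremePoints ha hb h0 h
    exact ⟨a, b, fun i => sq_eq_one_iff.1 (h₁ i), fun j => sq_eq_one_iff.1 (h₂ j), rfl⟩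
  · rintro ⟨a, b, ha, hb, rfl⟩
    refine mem_extremePoints_of_sq_eq_one hC fun x y => ?_
    rw [Matrix.vecMulVec_apply, mul_pow, sq_eq_one_iff.2 (ha x), sq_eq_one_iff.2 (hb y), one_mul]

/-! ### Correlators of rank two -/

/-- If no cycle inequality is tight, then every entry in `(-1, 1)` can be moved on its own. -/
lemma exists_saturatesCycle_of_mem_extremePoints {C : Matrix (Fin 2) (Fin 2) ℝ}
    (h : C ∈ (Cor 2 2).extremePoints ℝ) : ∃ e, SaturatesCycle C e := by
  have h1 := sq_le_one_of_mem_cor h.1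
  obtain ⟨k, hk⟩ := mem_cor_iff.1 h.1
  rw [exists_saturatesCycle_iff h1]
  by_contra! hne
  obtain ⟨l₀, g₀⟩ := abs_le.1 (hk 0).abs_sub_le
  obtain ⟨l₁, g₁⟩ := abs_le.1 (hk 1).abs_sub_le
  have hlt : |C 0 0 * C 0 1 - C 1 0 * C 1 1| <
      √(1 - C 0 0 ^ 2) * √(1 - C 0 1 ^ 2) + √(1 - C 1 0 ^ 2) * √(1 - C 1 1 ^ 2) := by
    rw [abs_lt]
    constructor
    · have := lt_of_le_of_ne (by linarith) hne.2
      linarith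
    · have := lt_of_le_of_ne (by linarith) hne.1
      linarith
  obtain ⟨x, y, hxy⟩ : ∃ x y, C x y ^ 2 ≠ 1 := by
    by_contra! hall
    simp only [hall, sub_self, Real.sqrt_zero, mul_zero, add_zero] at hlt
    exact absurd hlt (abs_nonneg _).not_gt
  set M : ℝ → Matrix (Fin 2) (Fin 2) ℝ := fun t => C + Matrix.single x y t with hM
  have hM0 : M 0 = C := by simp [hM]
  have hMc : ∀ i j, Continuous fun t => M t i j := fun i j => by
    simp only [hM, Matrix.add_apply, Matrix.single_apply]
    split_ifs <;> fun_prop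
  have hev : ∀ᶠ t in nhds (0 : ℝ), M t ∈ Cor 2 2 := by
    have e₁ : ∀ᶠ t in nhds (0 : ℝ), |M t 0 0 * M t 0 1 - M t 1 0 * M t 1 1| <
        √(1 - M t 0 0 ^ 2) * √(1 - M t 0 1 ^ 2) + √(1 - M t 1 0 ^ 2) * √(1 - M t 1 1 ^ 2) := by
      have := hMc 0 0
      have := hMc 0 1
      have := hMc 1 0
      have := hMc 1 1
      refine ContinuousAt.eventually_lt (by fun_prop) (by fun_prop) ?_
      rwa [hM0]
    have e₂ : ∀ᶠ t in nhds (0 : ℝ), M t x y ^ 2 < 1 := by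
      have := hMc x y
      refine ContinuousAt.eventually_lt (by fun_prop) (by fun_prop) ?_
      rw [hM0]
      exact lt_of_le_of_ne (h1 x y) hxy
    filter_upwards [e₁, e₂] with t h₁ h₂
    refine mem_cor_of_abs_sub_le (fun i j => ?_) h₁.le
    by_cases hij : x = i ∧ y = j
    · obtain ⟨rfl, rfl⟩ := hij
      exact h₂.le
    · simpa [hM, Matrix.single_apply, hij] using h1 i j
  have hev' : ∀ᶠ t in nhds (0 : ℝ), M (-t) ∈ Cor 2 2 :=
    (continuous_neg.tendsto' (0 : ℝ) 0 neg_zero).eventually hev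
  obtain ⟨t, ⟨ht₁, ht₂⟩, ht₀⟩ := (((hev.and hev').filter_mono nhdsWithin_le_nhds).and
    (self_mem_nhdsWithin : {(0 : ℝ)}ᶜ ∈ nhdsWithin 0 {(0 : ℝ)}ᶜ)).exists
  have hd := eq_zero_of_mem_extremePoints (d := Matrix.single x y t) h ht₁ (by
    convert! ht₂ using 1
    rw [sub_eq_add_neg, hM]
    congr 1
    ext i j
    simp only [Matrix.neg_apply, Matrix.single_apply]
    split_ifs <;> simp)
  have := congrFun (congrFun hd x) y
  rw [Matrix.single_apply_same] at this
  exact ht₀ this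

/-- Two entries `±1` in one line make the matrix singular, and two entries `±1` on a diagonal leave
`k` as a free parameter. -/
lemma eq_of_sq_eq_one_of_mem_extremePoints {C : Matrix (Fin 2) (Fin 2) ℝ}
    (h : C ∈ (Cor 2 2).extremePoints ℝ) (hdet : C.det ≠ 0) (p q : Fin 2 × Fin 2)
    (hp : C p.1 p.2 ^ 2 = 1) (hq : C q.1 q.2 ^ 2 = 1) : p = q := by
  obtain ⟨k, hk⟩ := mem_cor_iff.1 h.1
  rw [Matrix.det_fin_two] at hdet
  have hrow : ∀ x, C x 0 ^ 2 = 1 → C x 1 ^ 2 = 1 → False := fun x h₀ h₁ => by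
    have e := (hk x).eq_mul_of_sq_eq_one h₀
    have hk1 : k ^ 2 = 1 := by rw [e, mul_pow, h₀, one_mul] at h₁; exact h₁
    have f₀ := (hk 0).cycle.eq_mul_of_sq_eq_one hk1
    have f₁ := (hk 1).cycle.eq_mul_of_sq_eq_one hk1
    rw [f₀, f₁] at hdet
    exact hdet (by ring)
  have hcol₀ : C 0 0 ^ 2 = 1 → C 1 0 ^ 2 = 1 → False := fun h₀ h₁ => by
    rw [(hk 0).eq_mul_of_sq_eq_one h₀, (hk 1).eq_mul_of_sq_eq_one h₁] at hdet
    exact hdet (by ring)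
  have hcol₁ : C 0 1 ^ 2 = 1 → C 1 1 ^ 2 = 1 → False := fun h₀ h₁ => by
    rw [(hk 0).symm.eq_mul_of_sq_eq_one h₀, (hk 1).symm.eq_mul_of_sq_eq_one h₁] at hdet
    exact hdet (by ring)
  have hfree : ∀ {σ κ : ℝ}, σ ^ 2 = 1 → κ ^ 2 ≤ 1 → InElliptope σ (σ * κ) κ :=
    fun {σ κ} hσ hκ => .of_sq_sub_le hσ.le (by rw [mul_pow, hσ, one_mul]; exact hκ)
      (by rw [hσ, ← mul_assoc, ← pow_two, hσ]; simp)
  have hroom : k ^ 2 ≠ 1 → ∃ ε : ℝ, ε ≠ 0 ∧ (k + ε) ^ 2 ≤ 1 ∧ (k - ε) ^ 2 ≤ 1 := fun hne => by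
    have hlt := (sq_lt_one_iff_abs_lt_one _).1 (lt_of_le_of_ne (hk 0).cycle.sq_le_one hne)
    obtain ⟨l, g⟩ := abs_le.1 (le_refl |k|)
    refine ⟨1 - |k|, by linarith, ?_, ?_⟩ <;> rw [sq_le_one_iff_abs_le_one, abs_le] <;>
      constructor <;> linarith
  have hdiag : C 0 0 ^ 2 = 1 → C 1 1 ^ 2 = 1 → False := fun h₀ h₁ => by
    have e₀ := (hk 0).eq_mul_of_sq_eq_one h₀
    have e₁ := (hk 1).symm.eq_mul_of_sq_eq_one h₁
    obtain ⟨ε, hε, hp, hm⟩ := hroom fun hk1 => hdet (by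
      rw [e₀, e₁]; linear_combination -(C 0 0 * C 1 1) * hk1)
    have hd := eq_zero_of_mem_extremePoints (d := !![0, C 0 0 * ε; C 1 1 * ε, 0]) h
      (mem_cor_iff.2 ⟨k + ε, Fin.forall_fin_two.2
        ⟨by simpa [e₀, mul_add] using hfree h₀ hp,
          by simpa [e₁, mul_add] using (hfree h₁ hp).symm⟩⟩)
      (mem_cor_iff.2 ⟨k - ε, Fin.forall_fin_two.2
        ⟨by simpa [e₀, mul_sub] using hfree h₀ hm,
          by simpa [e₁, mul_sub] using (hfree h₁ hm).symm⟩⟩)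
    have : C 0 0 * ε = 0 := by simpa using congrFun (congrFun hd 0) 1
    rcases mul_eq_zero.1 this with h' | h'
    · rw [h'] at h₀; norm_num at h₀
    · exact hε h'
  have hanti : C 0 1 ^ 2 = 1 → C 1 0 ^ 2 = 1 → False := fun h₀ h₁ => by
    have e₀ := (hk 0).symm.eq_mul_of_sq_eq_one h₀
    have e₁ := (hk 1).eq_mul_of_sq_eq_one h₁
    obtain ⟨ε, hε, hp, hm⟩ := hroom fun hk1 => hdet (by
      rw [e₀, e₁]; linear_combination (C 0 1 * C 1 0) * hk1)
    have hd := eq_zero_of_mem_extremePoints (d := !![C 0 1 * ε, 0; 0, C 1 0 * ε]) h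
      (mem_cor_iff.2 ⟨k + ε, Fin.forall_fin_two.2
        ⟨by simpa [e₀, mul_add] using (hfree h₀ hp).symm,
          by simpa [e₁, mul_add] using hfree h₁ hp⟩⟩)
      (mem_cor_iff.2 ⟨k - ε, Fin.forall_fin_two.2
        ⟨by simpa [e₀, mul_sub] using (hfree h₀ hm).symm,
          by simpa [e₁, mul_sub] using hfree h₁ hm⟩⟩)
    have : C 0 1 * ε = 0 := by simpa using congrFun (congrFun hd 0) 0
    rcases mul_eq_zero.1 this with h' | h'
    · rw [h'] at h₀; norm_num at h₀
    · exact hε h'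
  obtain ⟨i, j⟩ := p
  obtain ⟨i', j'⟩ := q
  fin_cases i <;> fin_cases j <;> fin_cases i' <;> fin_cases j' <;>
    first
    | rfl
    | exact (hrow _ hp hq).elim
    | exact (hrow _ hq hp).elim
    | exact (hcol₀ hp hq).elim
    | exact (hcol₀ hq hp).elim
    | exact (hcol₁ hp hq).elim
    | exact (hcol₁ hq hp).elim
    | exact (hdiag hp hq).elim
    | exact (hdiag hq hp).elim
    | exact (hanti hp hq).elim
    | exact (hanti hq hp).elim

/-- A tight cycle inequality determines the completion `k` and puts both rows on the boundary of
the elliptope; as at most one entry is `±1`, the completion lies in `(-1, 1)`. -/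
lemma sq_lt_one_and_sq_sub_eq_of_saturatesCycle {C : Matrix (Fin 2) (Fin 2) ℝ} {k : ℝ}
    (hk : ∀ x, InElliptope (C x 0) (C x 1) k)
    (hbox : ∀ p q : Fin 2 × Fin 2, C p.1 p.2 ^ 2 = 1 → C q.1 q.2 ^ 2 = 1 → p = q)
    {e : (Fin 2 × Fin 2) × Side} (he : SaturatesCycle C e) :
    k ^ 2 < 1 ∧ ∀ x, (k - C x 0 * C x 1) ^ 2 = (1 - C x 0 ^ 2) * (1 - C x 1 ^ 2) := by
  have h1 := sq_le_one_of_mem_cor (mem_cor_iff.2 ⟨k, hk⟩)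
  -- `x` is the row whose lower endpoint is the upper endpoint of the row `x'`
  obtain ⟨x, x', hall, hx⟩ : ∃ x x' : Fin 2, (∀ i, i = x ∨ i = x') ∧
      C x 0 * C x 1 - √(1 - C x 0 ^ 2) * √(1 - C x 1 ^ 2) =
        C x' 0 * C x' 1 + √(1 - C x' 0 ^ 2) * √(1 - C x' 1 ^ 2) := by
    rcases (exists_saturatesCycle_iff h1).1 ⟨e, he⟩ with h | h
    · exact ⟨0, 1, by decide, h⟩
    · exact ⟨1, 0, by decide, h⟩
  obtain ⟨l, -⟩ := abs_le.1 (hk x).abs_sub_le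
  obtain ⟨-, g⟩ := abs_le.1 (hk x').abs_sub_le
  have ex : k - C x 0 * C x 1 = -(√(1 - C x 0 ^ 2) * √(1 - C x 1 ^ 2)) := by linarith
  have ex' : k - C x' 0 * C x' 1 = √(1 - C x' 0 ^ 2) * √(1 - C x' 1 ^ 2) := by linarith
  refine ⟨lt_of_le_of_ne (hk 0).cycle.sq_le_one fun hk1 => ?_, fun i => ?_⟩
  · have f := (hk x).cycle.eq_mul_of_sq_eq_one hk1
    have f' := (hk x').cycle.eq_mul_of_sq_eq_one hk1
    have s : C x 1 ^ 2 = C x 0 ^ 2 := by rw [f, mul_pow, hk1, one_mul]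
    have s' : C x' 1 ^ 2 = C x' 0 ^ 2 := by rw [f', mul_pow, hk1, one_mul]
    rw [s, Real.mul_self_sqrt (by linarith [h1 x 0]), f] at ex
    rw [s', Real.mul_self_sqrt (by linarith [h1 x' 0]), f'] at ex'
    -- `k = 1` forces `±1` entries in the row `x`, and `k = -1` in the row `x'`
    rcases sq_eq_one_iff.1 hk1 with rfl | rfl
    · have h₀ : C x 0 ^ 2 = 1 := by linarith
      have := hbox (x, 0) (x, 1) h₀ (s.trans h₀)
      simp at this
    · have h₀ : C x' 0 ^ 2 = 1 := by linarith
      have := hbox (x', 0) (x', 1) h₀ (s'.trans h₀)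
      simp at this
  · rcases hall i with rfl | rfl
    · rw [ex, neg_sq, mul_pow, Real.sq_sqrt (by linarith [h1 i 0]),
        Real.sq_sqrt (by linarith [h1 i 1])]
    · rw [ex', mul_pow, Real.sq_sqrt (by linarith [h1 i 0]),
        Real.sq_sqrt (by linarith [h1 i 1])]

/-- A row without entries `±1` is an extreme point of the elliptope and so determines itself and
`k`; in a row with an entry `±1`, that entry and `k` determine the other one. -/
lemma mem_extremePoints_of_saturatesCycle {C : Matrix (Fin 2) (Fin 2) ℝ} (hC : C ∈ Cor 2 2)
    (hbox : ∀ p q : Fin 2 × Fin 2, C p.1 p.2 ^ 2 = 1 → C q.1 q.2 ^ 2 = 1 → p = q)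
    {e : (Fin 2 × Fin 2) × Side} (he : SaturatesCycle C e) :
    C ∈ (Cor 2 2).extremePoints ℝ := by
  refine ⟨hC, fun D₁ h₁ D₂ h₂ => ?_⟩
  rintro ⟨t, u, ht, hu, htu, hD⟩
  obtain ⟨k₁, hk₁⟩ := mem_cor_iff.1 h₁
  obtain ⟨k₂, hk₂⟩ := mem_cor_iff.1 h₂
  have hentry : ∀ x y, t * D₁ x y + u * D₂ x y = C x y := fun x y => by rw [← hD]; simp
  obtain ⟨k, hkdef⟩ : ∃ k, t * k₁ + u * k₂ = k := ⟨_, rfl⟩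
  have hk : ∀ x, InElliptope (C x 0) (C x 1) k := fun x => by
    rw [← hentry, ← hentry, ← hkdef]
    exact (hk₁ x).convexComb (hk₂ x) ht.le hu.le htu
  have h1 := sq_le_one_of_mem_cor hC
  obtain ⟨hk1, hbdry⟩ := sq_lt_one_and_sq_sub_eq_of_saturatesCycle hk hbox he
  have hopen : ∀ x, C x 0 ^ 2 ≠ 1 → C x 1 ^ 2 ≠ 1 →
      D₁ x 0 = C x 0 ∧ D₁ x 1 = C x 1 ∧ k₁ = k := fun x hx₀ hx₁ =>
    (hk₁ x).eq_of_convexComb (hk₂ x) ht hu htu (hentry x 0) (hentry x 1) hkdef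
      (lt_of_le_of_ne (h1 x 0) hx₀) (lt_of_le_of_ne (h1 x 1) hx₁) hk1 (hbdry x)
  have hkk : k₁ = k := by
    by_cases h0 : C 0 0 ^ 2 ≠ 1 ∧ C 0 1 ^ 2 ≠ 1
    · exact (hopen 0 h0.1 h0.2).2.2
    · obtain ⟨y, hy⟩ : ∃ y, C 0 y ^ 2 = 1 := by
        by_contra! hne
        exact h0 ⟨hne 0, hne 1⟩
      have hne : ∀ y', C 1 y' ^ 2 ≠ 1 := fun y' hy' => by
        have := congrArg Prod.fst (hbox (0, y) (1, y') hy hy')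
        simp at this
      exact (hopen 1 (hne 0) (hne 1)).2.2
  have hfix : ∀ x y, C x y ^ 2 = 1 → D₁ x y = C x y := fun x y hxy =>
    eq_of_convexComb_of_sq_eq_one (sq_le_one_of_mem_cor h₁ x y) (sq_le_one_of_mem_cor h₂ x y)
      ht hu htu (hentry x y) hxy
  ext x y
  revert y
  rw [Fin.forall_fin_two]
  by_cases hx₀ : C x 0 ^ 2 = 1
  · have e₀ := hfix x 0 hx₀
    refine ⟨e₀, ?_⟩
    rw [(hk₁ x).eq_mul_of_sq_eq_one (by rw [e₀]; exact hx₀), (hk x).eq_mul_of_sq_eq_one hx₀, e₀,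
      hkk]
  by_cases hx₁ : C x 1 ^ 2 = 1
  · have e₁ := hfix x 1 hx₁
    refine ⟨?_, e₁⟩
    rw [(hk₁ x).symm.eq_mul_of_sq_eq_one (by rw [e₁]; exact hx₁),
      (hk x).symm.eq_mul_of_sq_eq_one hx₁, e₁, hkk]
  · exact ⟨(hopen x hx₀ hx₁).1, (hopen x hx₀ hx₁).2.1⟩

lemma mem_extremePoints_iff_of_rank_eq_two {C : Matrix (Fin 2) (Fin 2) ℝ} (hC : C ∈ Cor 2 2)
    (hr : C.rank = 2) :
    C ∈ (Cor 2 2).extremePoints ℝ ↔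
      (∃! e, SaturatesCycle C e) ∧ {e | SaturatesBox C e}.Subsingleton := by
  have h1 := sq_le_one_of_mem_cor hC
  constructor
  · intro h
    have hdet : C.det ≠ 0 := fun hdet => by
      obtain ⟨a, b, -, -, hab⟩ := exists_eq_vecMulVec_of_det_eq_zero h1 hdet
      have := Matrix.rank_vecMulVec_le a b
      rw [← hab, hr] at this
      norm_num at this
    have hbox := (subsingleton_saturatesBox_iff h1).2
      (eq_of_sq_eq_one_of_mem_extremePoints h hdet)
    obtain ⟨e, he⟩ := exists_saturatesCycle_of_mem_extremePoints h
    exact ⟨⟨e, he, fun e' he' => eq_of_saturatesCycle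
      (fun p q s s' hp hq => congrArg Prod.fst (hbox hp hq)) he' he⟩, hbox⟩
  · rintro ⟨⟨e, he, -⟩, hbox⟩
    exact mem_extremePoints_of_saturatesCycle hC ((subsingleton_saturatesBox_iff h1).1 hbox) he

end QuantumCorrelator

end

theorem mainTheorem4 (C : Matrix (Fin 2) (Fin 2) ℝ) (hC : C ∈ QuantumCorrelator.Cor 2 2) :
    (C.rank = 1 →
      (C ∈ Set.extremePoints ℝ (QuantumCorrelator.Cor 2 2) ↔
        ∃ x y : Fin 2 → ℝ, (∀ i, x i = 1 ∨ x i = -1) ∧ (∀ j, y j = 1 ∨ y j = -1) ∧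
          C = Matrix.vecMulVec x y)) ∧
    (C.rank = 2 →
      (C ∈ Set.extremePoints ℝ (QuantumCorrelator.Cor 2 2) ↔
        (∃! e : (Fin 2 × Fin 2) × QuantumCorrelator.Side,
          QuantumCorrelator.SaturatesCycle C e) ∧
        {e : (Fin 2 × Fin 2) × QuantumCorrelator.Side |
          QuantumCorrelator.SaturatesBox C e}.Subsingleton)) :=
  ⟨QuantumCorrelator.mem_extremePoints_iff_of_rank_eq_one hC,
    QuantumCorrelator.mem_extremePoints_iff_of_rank_eq_two hC⟩
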